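/- For a permutation $\tau$ of $[n]=\{1,\dots,n\}$, let $\mathrm{lrec}(\tau)$ be its number of low records (left-to-right minima), i.e. of positions $i\in[n]$ such that $\tau(j)>\tau(i)$ for all $j<i$. A cycle type of size $n$ is a sequence $t=(t_1,\dots,t_n)$ of nonnegative integers with $\sum_{p=1}^n p\,t_p=n$; a permutation of $[n]$ is $t$-cyclic if, for every $p$, it has exactly $t_p$ cycles of length $p$ (fixed points being the cycles of length $1$). For each $n$, let $t^{(n)}$ be a cycle type of size $n$ such that $t_1^{(n)}=O(\sqrt n)$ as $n\to\infty$, and let $\tau_n$ be a uniformly random $t^{(n)}$-cyclic permutation. 1. If $t_1^{(n)}+2t_2^{(n)}=n$ for all $n$ (that is, $\tau_n$ is a product of disjoint $2$-cycles), then, in distribution as $n\to\infty$, $$\frac{\mathrm{lrec}(\tau_n)-\log n}{\sqrt{\log n}}\longrightarrow \mathcal N(0,2).$$ 2. If $t_1^{(n)}+3t_3^{(n)}=n$ for all $n$ (that is, $\tau_n$ is a product of disjoint $3$-cycles), then, in distribution as $n\to\infty$, $$\frac{\mathrm{lrec}(\tau_n)-\log n}{\sqrt{\log n}}\longrightarrow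 \mathcal N(0,1).$$ Here $\mathcal N(0,\sigma^2)$ is the centred normal law with variance $\sigma^2$. -/

import Mathlib

open MeasureTheory ProbabilityTheory Filter Asymptotics

/-- The number of low records (left-to-right minima) of a permutation `σ`: positions `i` such
that `σ j > σ i` for every `j < i`. -/
def lrec {n : ℕ} (σ : Equiv.Perm (Fin n)) : ℕ :=
  (Finset.univ.filter fun i : Fin n => ∀ j : Fin n, j < i → σ i < σ j).card

/-- The coordinate `t_p` of a cycle type `t` of size `n`: the number of cycles of length `p`.
Cycle types of size `n` (sequences `t_1, ..., t_n` with `∑ p * t_p = n`) are encoded by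
partitions of `n`, in which the part `p` has multiplicity `t_p`. -/
def numCycles {n : ℕ} (t : n.Partition) (p : ℕ) : ℕ :=
  t.parts.count p

/-- The set of `t`-cyclic permutations: those whose cycle lengths, fixed points included
(as cycles of length one), are the parts of `t`. -/
def cyclicPerms {n : ℕ} (t : n.Partition) : Set (Equiv.Perm (Fin n)) :=
  {σ | σ.partition.parts = t.parts}

/-- The finite set of permutations carries the discrete `σ`-algebra. -/
instance permFinMeasurableSpace (n : ℕ) : MeasurableSpace (Equiv.Perm (Fin n)) := ⊤

/-- Every set of permutations is measurable. -/
instance permFinDiscreteMeasurableSpace (n : ℕ) :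
    DiscreteMeasurableSpace (Equiv.Perm (Fin n)) :=
  ⟨fun _ => trivial⟩

/-! With b = (log n)^(1/16), put m ≈ √n/b and L ≈ √n·b². The expected number of graph points of σ in
the square of side m is at most about m·t₁/n + m²/n → 0, so with high probability σ is separated: it
maps no point below m to a point below m. The low records of a separated σ split into those at
positions below m, those with values below m, and a remainder. Being a record is symmetric under
transposing the graph, so the first two kinds are the left-to-right minima of the words (σ k)_{k<m}
and (σ⁻¹ k)_{k<m}.

The law of σ is invariant under conjugation. Conjugating by a permutation π that fixes every point
below m composes both words with π, so each is a uniformly random ordering, whose number of minima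
has generating function ∏_{j<m} (x+j)/(j+1). If σ² = 1 the two words coincide, and one count of
minima is doubled. If σ³ = 1 the words of a separated σ have disjoint values, and their orderings
are independent. One count has mean and variance close to log m ≈ (log n)/2, so the sum has variance
about 4·(log n)/2 = 2 log n for 2-cycles and 2·(log n)/2 = log n for 3-cycles.

The remaining records lie in the square of side L unless one word avoids all values below L, which
has probability O(1/b). That square contains O(b⁴) points on average, negligible against √(log n) =
b⁸. Lévy's continuity theorem turns these estimates into convergence in distribution. -/

/-- The number of left-to-right minima of a finite sequence. -/
def numLeftMin {m : ℕ} {α : Type*} [LinearOrder α] (f : Fin m → α) : ℕ :=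
  (Finset.univ.filter fun i : Fin m => ∀ j : Fin m, j < i → f i < f j).card

/-- The number of right-to-left minima of a finite sequence. -/
def numRightMin {m : ℕ} {α : Type*} [LinearOrder α] (f : Fin m → α) : ℕ :=
  (Finset.univ.filter fun i : Fin m => ∀ j : Fin m, i < j → f i < f j).card

/-! ### Records of a random ordering -/

section Records

variable {α : Type*} [LinearOrder α]

lemma numLeftMin_comp_rev {m : ℕ} (f : Fin m → α) :
    numLeftMin (f ∘ Fin.revPerm) = numRightMin f := by
  unfold numLeftMin numRightMin
  refine Finset.card_equiv Fin.revPerm fun i => ?_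
  simp only [Finset.mem_filter, Finset.mem_univ, true_and, Function.comp, Fin.revPerm_apply]
  constructor
  · intro h j hj
    simpa using h j.rev (by rw [← Fin.rev_lt_rev]; simpa using hj)
  · intro h j hj
    exact h j.rev (by simpa using hj)

lemma numRightMin_succ {m : ℕ} (f : Fin (m + 1) → α) :
    numRightMin f = (if ∀ j : Fin m, f 0 < f j.succ then 1 else 0) + numRightMin (f ∘ Fin.succ) := by
  unfold numRightMin
  rw [Fin.card_filter_univ_succ]
  simp only [Fin.forall_fin_succ, Fin.succ_pos, Fin.succ_lt_succ_iff, Fin.not_lt_zero,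
    lt_self_iff_false, false_imp_iff, true_imp_iff, true_and, Function.comp]
  split_ifs <;> simp [add_comm]

/-- Deleting the first entry does not affect whether later entries are right-to-left minima, which
makes this side convenient for induction. The first entry is itself one exactly when it is the
overall minimum: of the m + 1 choices of first entry one contributes x and the others 1, giving the
factor x + m. -/
lemma sum_pow_numRightMin_comp {m : ℕ} (f : Fin m → α) (hf : Function.Injective f) (x : ℂ) :
    ∑ ρ : Equiv.Perm (Fin m), x ^ numRightMin (f ∘ ρ) = ∏ j ∈ Finset.range m, (x + j) := by
  induction m with
  | zero => simp [numRightMin]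
  | succ m ih =>
    obtain ⟨k, hk⟩ := Finite.exists_min f
    rw [← Equiv.sum_comp Equiv.Perm.decomposeFin.symm, Fintype.sum_prod_type]
    have key : ∀ p : Fin (m + 1), ∀ e : Equiv.Perm (Fin m),
        x ^ numRightMin (f ∘ Equiv.Perm.decomposeFin.symm (p, e)) =
        (if p = k then x else 1) *
          x ^ numRightMin ((f ∘ Equiv.swap 0 p ∘ Fin.succ) ∘ e) := by
      intro p e
      rw [numRightMin_succ, pow_add]
      congr 1
      · have : (∀ j : Fin m, f p < f (Equiv.swap 0 p (e j).succ)) ↔ p = k := by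
          constructor
          · intro h
            by_contra hpk
            have h0 : Equiv.swap 0 p k ≠ 0 := by
              intro h0
              apply hpk
              have := congrArg (Equiv.swap 0 p) h0
              simpa using this.symm
            obtain ⟨l, hl⟩ := Fin.exists_succ_eq.2 h0
            have := h (e.symm l)
            simp only [Equiv.apply_symm_apply, hl, Equiv.swap_apply_self] at this
            exact absurd (hk p) (not_le.2 this)
          · rintro rfl j
            refine lt_of_le_of_ne (hk _) fun h => ?_
            have h2 := congrArg (Equiv.swap 0 p) (hf h)
            simp only [Equiv.swap_apply_right, Equiv.swap_apply_self] at h2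
            exact (Fin.succ_ne_zero _) h2.symm
        simp only [Function.comp, Equiv.Perm.decomposeFin_symm_apply_zero,
          Equiv.Perm.decomposeFin_symm_apply_succ, this]
        split_ifs <;> simp
      · congr 2
        ext j
        simp
    simp_rw [key, ← Finset.mul_sum]
    have h2 : ∀ p : Fin (m + 1), ∑ e : Equiv.Perm (Fin m),
        x ^ numRightMin ((f ∘ Equiv.swap 0 p ∘ Fin.succ) ∘ e) = ∏ j ∈ Finset.range m, (x + j) :=
      fun p => ih _ (hf.comp ((Equiv.injective _).comp (Fin.succ_injective _)))
    simp_rw [h2, ← Finset.sum_mul]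
    rw [Finset.prod_range_succ, mul_comm]
    congr 1
    rw [← Finset.add_sum_erase _ _ (Finset.mem_univ k), if_pos rfl,
      Finset.sum_congr rfl (g := fun _ => (1 : ℂ))
        (fun i hi => if_neg (Finset.ne_of_mem_erase hi))]
    simp

lemma sum_pow_numLeftMin_comp {m : ℕ} (f : Fin m → α) (hf : Function.Injective f) (x : ℂ) :
    ∑ ρ : Equiv.Perm (Fin m), x ^ numLeftMin (f ∘ ρ) = ∏ j ∈ Finset.range m, (x + j) := by
  rw [← sum_pow_numRightMin_comp f hf x,
    ← Equiv.sum_comp (Equiv.mulRight (Fin.revPerm : Equiv.Perm (Fin m)))]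
  refine Finset.sum_congr rfl fun ρ _ => ?_
  rw [← numLeftMin_comp_rev]
  rfl

end Records

/-- The probability generating function of the number of left-to-right minima of a uniformly
random ordering of `m` elements. -/
noncomputable def recordPgf (m : ℕ) (x : ℂ) : ℂ :=
  ∏ j ∈ Finset.range m, (x + j) / (j + 1)

lemma factorial_mul_recordPgf (m : ℕ) (x : ℂ) :
    (m.factorial : ℂ) * recordPgf m x = ∏ j ∈ Finset.range m, (x + j) := by
  rw [recordPgf, Finset.prod_div_distrib, ← Finset.prod_range_add_one_eq_factorial]
  push_cast
  rw [mul_div_cancel₀]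
  exact Finset.prod_ne_zero_iff.2 fun i _ => Nat.cast_add_one_ne_zero i

/-! ### Averaging over permutations that fix the points below m -/

section Fixing

variable {n : ℕ}

/-- The permutations of `Fin n` that fix every element below `m`. -/
def fixingPerms (n m : ℕ) : Finset (Equiv.Perm (Fin n)) :=
  Finset.univ.filter fun π => ∀ i : Fin n, (i : ℕ) < m → π i = i

lemma mem_fixingPerms {m : ℕ} {π : Equiv.Perm (Fin n)} :
    π ∈ fixingPerms n m ↔ ∀ i : Fin n, (i : ℕ) < m → π i = i := by
  simp [fixingPerms]

lemma card_fixingPerms_pos (n m : ℕ) : 0 < (fixingPerms n m).card :=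
  Finset.card_pos.2 ⟨1, mem_fixingPerms.2 fun _ _ => rfl⟩

lemma mul_mem_fixingPerms {m : ℕ} {π ρ : Equiv.Perm (Fin n)} (hπ : π ∈ fixingPerms n m)
    (hρ : ρ ∈ fixingPerms n m) : π * ρ ∈ fixingPerms n m := by
  rw [mem_fixingPerms] at *
  intro i hi
  rw [Equiv.Perm.mul_apply, hρ i hi, hπ i hi]

lemma inv_mem_fixingPerms {m : ℕ} {π : Equiv.Perm (Fin n)} (hπ : π ∈ fixingPerms n m) :
    π⁻¹ ∈ fixingPerms n m := by
  rw [mem_fixingPerms] at *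
  intro i hi
  rw [Equiv.Perm.inv_eq_iff_eq, hπ i hi]

lemma le_apply_of_mem_fixingPerms {m : ℕ} {π : Equiv.Perm (Fin n)} (hπ : π ∈ fixingPerms n m)
    {i : Fin n} (hi : m ≤ i) : m ≤ π i := by
  by_contra! h
  have := mem_fixingPerms.1 hπ _ h
  rw [π.injective this] at h
  omega

lemma sum_fixingPerms_mul {M : Type*} [AddCommMonoid M] {m : ℕ} {ρ : Equiv.Perm (Fin n)}
    (hρ : ρ ∈ fixingPerms n m) (F : Equiv.Perm (Fin n) → M) :
    ∑ π ∈ fixingPerms n m, F (π * ρ) = ∑ π ∈ fixingPerms n m, F π := by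
  refine Finset.sum_equiv (Equiv.mulRight ρ) (fun π => ?_) fun _ _ => rfl
  refine ⟨fun h => mul_mem_fixingPerms h hρ, fun h => ?_⟩
  simpa using mul_mem_fixingPerms h (inv_mem_fixingPerms hρ)

/-- Exchangeability of the word π ∘ g: since g takes values at least m, ρ transported to the range
of g fixes the points below m, and can be absorbed into π. -/
lemma sum_fixingPerms_comp_perm {M : Type*} [AddCommMonoid M] {m : ℕ} {ι : Type*} [Fintype ι]
    [DecidableEq ι] (g : ι → Fin n) (hg : Function.Injective g) (hm : ∀ k, m ≤ g k)
    (F : (ι → Fin n) → M) (ρ : Equiv.Perm ι) :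
    ∑ π ∈ fixingPerms n m, F (π ∘ g ∘ ρ) = ∑ π ∈ fixingPerms n m, F (π ∘ g) := by
  have hρ : ρ.viaFintypeEmbedding ⟨g, hg⟩ ∈ fixingPerms n m := by
    rw [mem_fixingPerms]
    intro i hi
    refine Equiv.Perm.viaFintypeEmbedding_apply_notMem_range _ _ ?_
    rintro ⟨k, rfl⟩
    exact absurd (hm k) (by simpa using hi)
  refine Eq.trans (Finset.sum_congr rfl fun π _ => ?_)
    (sum_fixingPerms_mul hρ fun π => F (π ∘ g))
  congr 1
  ext k
  have := Equiv.Perm.viaFintypeEmbedding_apply_image ρ ⟨g, hg⟩ k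
  simp only [Function.Embedding.coeFn_mk] at this
  simp [this]

lemma sum_fixingPerms_pow_numLeftMin {m : ℕ} (g : Fin m → Fin n) (hg : Function.Injective g)
    (hm : ∀ k, m ≤ g k) (x : ℂ) :
    ∑ π ∈ fixingPerms n m, x ^ numLeftMin (π ∘ g) = (fixingPerms n m).card * recordPgf m x := by
  -- Averaging also over ρ changes nothing; after exchanging the sums, the inner sum over ρ is
  -- explicit for each fixed π.
  have h := Finset.sum_congr (M := ℂ) rfl (fun ρ (_ : ρ ∈ (Finset.univ : Finset (Equiv.Perm (Fin m)))) =>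
    sum_fixingPerms_comp_perm g hg hm (fun f => x ^ numLeftMin f) ρ)
  rw [Finset.sum_comm] at h
  simp_rw [← Function.comp_assoc] at h
  rw [Finset.sum_congr rfl fun π (_ : π ∈ fixingPerms n m) =>
    sum_pow_numLeftMin_comp (⇑π ∘ g) (π.injective.comp hg) x] at h
  rw [← factorial_mul_recordPgf] at h
  simp only [Finset.sum_const, nsmul_eq_mul, Finset.card_univ, Fintype.card_perm,
    Fintype.card_fin] at h
  have h0 : (m.factorial : ℂ) ≠ 0 := Nat.cast_ne_zero.2 m.factorial_ne_zero
  apply mul_left_cancel₀ h0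
  rw [← h]
  ring

/-- Disjoint ranges allow the two words to be shuffled independently, so the generating function
factors. -/
lemma sum_fixingPerms_pow_numLeftMin_add {m : ℕ} (f g : Fin m → Fin n)
    (hfg : Function.Injective (Sum.elim f g)) (hf : ∀ k, m ≤ f k) (hg : ∀ k, m ≤ g k) (x : ℂ) :
    ∑ π ∈ fixingPerms n m, x ^ (numLeftMin (π ∘ f) + numLeftMin (π ∘ g)) =
      (fixingPerms n m).card * recordPgf m x ^ 2 := by
  have hfi : Function.Injective f := by
    have := hfg.comp Sum.inl_injective
    rwa [Sum.elim_comp_inl] at this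
  have hgi : Function.Injective g := by
    have := hfg.comp Sum.inr_injective
    rwa [Sum.elim_comp_inr] at this
  have h := Finset.sum_congr (M := ℂ) rfl
    (fun ρ (_ : ρ ∈ (Finset.univ : Finset (Equiv.Perm (Fin m) × Equiv.Perm (Fin m)))) =>
    sum_fixingPerms_comp_perm (m := m) (Sum.elim f g) hfg (by rintro (k | k) <;> simp [hf, hg])
      (fun F => x ^ (numLeftMin (F ∘ Sum.inl) + numLeftMin (F ∘ Sum.inr)))
      (Equiv.sumCongr ρ.1 ρ.2))
  rw [Finset.sum_comm] at h
  have e : ∀ π ∈ fixingPerms n m, ∑ ρ : Equiv.Perm (Fin m) × Equiv.Perm (Fin m),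
      x ^ (numLeftMin ((⇑π ∘ Sum.elim f g ∘ ⇑(Equiv.sumCongr ρ.1 ρ.2)) ∘ Sum.inl) +
        numLeftMin ((⇑π ∘ Sum.elim f g ∘ ⇑(Equiv.sumCongr ρ.1 ρ.2)) ∘ Sum.inr)) =
      (m.factorial * recordPgf m x) ^ 2 := by
    intro π _
    rw [Fintype.sum_prod_type, sq, factorial_mul_recordPgf]
    nth_rewrite 1 [← sum_pow_numLeftMin_comp (π ∘ f) (π.injective.comp hfi) x]
    rw [← sum_pow_numLeftMin_comp (π ∘ g) (π.injective.comp hgi) x, Finset.sum_mul_sum]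
    simp_rw [← pow_add]
    rfl
  rw [Finset.sum_congr rfl e] at h
  simp only [Finset.sum_const, nsmul_eq_mul, Finset.card_univ, Fintype.card_prod,
    Fintype.card_perm, Fintype.card_fin, Nat.cast_mul, Function.comp_assoc, Sum.elim_comp_inl,
    Sum.elim_comp_inr] at h
  have h0 : (m.factorial : ℂ) ≠ 0 := Nat.cast_ne_zero.2 m.factorial_ne_zero
  apply mul_left_cancel₀ (mul_ne_zero h0 h0)
  rw [← h]
  ring

/-- By symmetry under transpositions within T, each element of T is equally likely to receive the
smallest image, and these events are disjoint. -/
lemma card_mul_card_filter_fixingPerms_le {m : ℕ} (T : Finset (Fin n)) (hT : ∀ z ∈ T, m ≤ z)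
    {y : Fin n} (hy : y ∈ T) :
    T.card * ((fixingPerms n m).filter fun π => ∀ w ∈ T, w ≠ y → π y < π w).card ≤
      (fixingPerms n m).card := by
  classical
  set A : Fin n → Finset (Equiv.Perm (Fin n)) :=
    fun z => (fixingPerms n m).filter fun π => ∀ w ∈ T, w ≠ z → π z < π w with hA
  have hcard : ∀ z ∈ T, (A z).card = (A y).card := by
    intro z hz
    have hs : Equiv.swap y z ∈ fixingPerms n m := by
      rw [mem_fixingPerms]
      intro i hi
      refine Equiv.swap_apply_of_ne_of_ne ?_ ?_
      · rintro rfl; have := hT _ hy; omega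
      · rintro rfl; have := hT _ hz; omega
    simp only [hA, Finset.card_filter]
    rw [← sum_fixingPerms_mul hs]
    refine Finset.sum_congr rfl fun π _ => if_congr ?_ rfl rfl
    have hmem : ∀ w ∈ T, Equiv.swap y z w ∈ T := fun w hw => by
      rw [Equiv.swap_apply_def]
      split_ifs <;> assumption
    constructor
    · intro h w hw hwy
      have := h (Equiv.swap y z w) (hmem w hw) (fun h' => hwy (by
        have := congrArg (Equiv.swap y z) h'
        simpa using this))
      simpa using this
    · intro h w hw hwy
      have := h (Equiv.swap y z w) (hmem w hw) (fun h' => hwy (by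
        have := congrArg (Equiv.swap y z) h'
        simpa using this))
      simpa using this
  have hdisj : (T : Set (Fin n)).PairwiseDisjoint A := by
    intro a ha b hb hab
    rw [Function.onFun, Finset.disjoint_left]
    intro π h1 h2
    simp only [hA, Finset.mem_filter] at h1 h2
    exact lt_asymm (h1.2 b hb hab.symm) (h2.2 a ha hab)
  calc T.card * (A y).card = ∑ z ∈ T, (A z).card := by
        rw [Finset.sum_congr rfl hcard, Finset.sum_const, smul_eq_mul]
    _ = (T.biUnion A).card := (Finset.card_biUnion hdisj).symm
    _ ≤ (fixingPerms n m).card :=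
        Finset.card_le_card (Finset.biUnion_subset.2 fun z _ => Finset.filter_subset _ _)

/-- Double count pairs (π, y) where y lies outside the range of g and π y is below the whole word π
∘ g. Each y is minimal among m + 1 exchangeable points, so it has probability at most 1/(m + 1); a π
whose word avoids the values below L admits at least L - m such y. -/
lemma card_fixingPerms_avoid_le {m L : ℕ} (hL : L ≤ n) (g : Fin m → Fin n)
    (hg : Function.Injective g) (hm : ∀ k, m ≤ g k) :
    (m + 1) * ((L - m) * ((fixingPerms n m).filter fun π => ∀ k, L ≤ π (g k)).card) ≤
      n * (fixingPerms n m).card := by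
  classical
  set D := (fixingPerms n m).filter fun π => ∀ k, L ≤ π (g k) with hD
  set A : Fin n → Finset (Equiv.Perm (Fin n)) := fun y =>
    (fixingPerms n m).filter fun π => m ≤ y ∧ (∀ k, y ≠ g k) ∧ ∀ k, π y < π (g k) with hA
  have h1 : ∀ y, (m + 1) * (A y).card ≤ (fixingPerms n m).card := by
    intro y
    by_cases hy : m ≤ y ∧ ∀ k, y ≠ g k
    · have hc : (insert y (Finset.univ.image g)).card = m + 1 := by
        rw [Finset.card_insert_of_notMem, Finset.card_image_of_injective _ hg, Finset.card_univ,
          Fintype.card_fin]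
        simp only [Finset.mem_image, Finset.mem_univ, true_and, not_exists]
        exact fun k h => hy.2 k h.symm
      refine le_trans ?_ (card_mul_card_filter_fixingPerms_le
        (insert y (Finset.univ.image g)) ?_ (Finset.mem_insert_self _ _))
      · rw [hc]
        refine Nat.mul_le_mul_left _ (Finset.card_le_card fun π hπ => ?_)
        simp only [hA, Finset.mem_filter] at hπ ⊢
        refine ⟨hπ.1, fun w hw hwy => ?_⟩
        simp only [Finset.mem_insert, Finset.mem_image, Finset.mem_univ, true_and] at hw
        rcases hw with rfl | ⟨k, rfl⟩
        · exact absurd rfl hwy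
        · exact hπ.2.2.2 k
      · intro z hz
        simp only [Finset.mem_insert, Finset.mem_image, Finset.mem_univ, true_and] at hz
        rcases hz with rfl | ⟨k, rfl⟩
        · exact hy.1
        · exact hm k
    · have : A y = ∅ := by
        rw [hA, Finset.filter_eq_empty_iff]
        exact fun π _ h => hy ⟨h.1, h.2.1⟩
      simp [this]
  have h2 : (L - m) * D.card ≤ ∑ y, (A y).card := by
    have : ∀ π ∈ D, L - m ≤ (Finset.univ.filter fun y => π ∈ A y).card := by
      intro π hπ
      simp only [hD, Finset.mem_filter] at hπ
      have hc : L - m = (Finset.Ico m L).card := by simp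
      rw [hc]
      -- The suitable y are the preimages under π of the values in [m, L).
      refine Finset.card_le_card_of_surjOn (fun y : Fin n => (π y : ℕ)) ?_
      intro x hx
      simp only [Finset.coe_Ico, Set.mem_Ico] at hx
      set x' : Fin n := ⟨x, by omega⟩
      refine ⟨π⁻¹ x', ?_, by simp [x']⟩
      have hlt : ∀ k, x' < π (g k) := fun k => Fin.lt_def.2 (by have := hπ.2 k; simp [x']; omega)
      simp only [hA, Finset.coe_filter, Finset.mem_univ, true_and, Finset.mem_filter,
        Set.mem_ofPred_eq]
      refine ⟨hπ.1, le_apply_of_mem_fixingPerms (inv_mem_fixingPerms hπ.1) hx.1, fun k h => ?_,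
        fun k => by simpa using hlt k⟩
      have := hlt k
      rw [← h] at this
      simp at this
    calc (L - m) * D.card = ∑ _π ∈ D, (L - m) := by rw [Finset.sum_const, smul_eq_mul, mul_comm]
      _ ≤ ∑ π ∈ D, (Finset.univ.filter fun y => π ∈ A y).card := Finset.sum_le_sum this
      _ ≤ ∑ π ∈ fixingPerms n m, (Finset.univ.filter fun y => π ∈ A y).card :=
          Finset.sum_le_sum_of_subset (Finset.filter_subset _ _)
      _ = ∑ y, (A y).card := by
          simp only [Finset.card_filter]
          rw [Finset.sum_comm]
          refine Finset.sum_congr rfl fun y _ => ?_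
          rw [hA, Finset.card_filter]
          refine Finset.sum_congr rfl fun π hπ => ?_
          simp [hπ]
  calc (m + 1) * ((L - m) * D.card) ≤ (m + 1) * ∑ y, (A y).card := Nat.mul_le_mul_left _ h2
    _ = ∑ y, (m + 1) * (A y).card := Finset.mul_sum _ _ _
    _ ≤ ∑ _y : Fin n, (fixingPerms n m).card := Finset.sum_le_sum fun y _ => h1 y
    _ = n * (fixingPerms n m).card := by simp

end Fixing

/-! ### Conjugation invariance and point counts for a fixed cycle type -/

section CyclicPerms

variable {n : ℕ}

/-- The finite set of `t`-cyclic permutations. -/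
def cyclicPermsFinset (t : n.Partition) : Finset (Equiv.Perm (Fin n)) :=
  Finset.univ.filter fun σ => σ.partition.parts = t.parts

lemma mem_cyclicPermsFinset {t : n.Partition} {σ : Equiv.Perm (Fin n)} :
    σ ∈ cyclicPermsFinset t ↔ σ.partition.parts = t.parts := by
  simp [cyclicPermsFinset]

lemma coe_cyclicPermsFinset (t : n.Partition) :
    (cyclicPermsFinset t : Set (Equiv.Perm (Fin n))) = cyclicPerms t := by
  ext σ
  simp [cyclicPermsFinset, cyclicPerms]

lemma conj_mem_cyclicPermsFinset {t : n.Partition} (π : Equiv.Perm (Fin n))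
    {σ : Equiv.Perm (Fin n)} :
    π * σ * π⁻¹ ∈ cyclicPermsFinset t ↔ σ ∈ cyclicPermsFinset t := by
  have h : IsConj σ (π * σ * π⁻¹) := isConj_iff.2 ⟨π, rfl⟩
  rw [mem_cyclicPermsFinset, mem_cyclicPermsFinset, Equiv.Perm.partition_eq_of_isConj.1 h]

lemma card_filter_conj {t : n.Partition} (π : Equiv.Perm (Fin n)) (p : Equiv.Perm (Fin n) → Prop)
    [DecidablePred p] :
    ((cyclicPermsFinset t).filter p).card =
      ((cyclicPermsFinset t).filter fun σ => p (π⁻¹ * σ * π)).card := by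
  refine Finset.card_equiv (MulAut.conj π).toEquiv fun σ => ?_
  simp only [Finset.mem_filter, MulEquiv.toEquiv_eq_coe, EquivLike.coe_coe, MulAut.conj_apply,
    conj_mem_cyclicPermsFinset]
  simp [mul_assoc]

/-- Conjugating by a transposition that fixes i shows that the n - 1 possible images of i other than
i are equally likely. -/
lemma card_filter_apply_eq_of_ne_le (t : n.Partition) {i j : Fin n} (hij : i ≠ j) :
    (n - 1) * ((cyclicPermsFinset t).filter fun σ => σ i = j).card ≤
      (cyclicPermsFinset t).card := by
  have h : ∀ k ∈ Finset.univ.erase i, ((cyclicPermsFinset t).filter fun σ => σ i = k).card =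
      ((cyclicPermsFinset t).filter fun σ => σ i = j).card := by
    intro k hk
    rw [card_filter_conj (Equiv.swap j k)]
    congr 1
    refine Finset.filter_congr fun σ _ => ?_
    rw [Equiv.swap_inv, Equiv.Perm.mul_apply, Equiv.Perm.mul_apply,
      Equiv.swap_apply_of_ne_of_ne hij (Finset.ne_of_mem_erase hk).symm, Equiv.swap_apply_eq_iff,
      Equiv.swap_apply_right]
  have h2 := Finset.sum_congr rfl h
  rw [Finset.sum_const, Finset.card_erase_of_mem (Finset.mem_univ _), Finset.card_univ,
    Fintype.card_fin, smul_eq_mul] at h2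
  rw [← h2, ← Finset.card_biUnion]
  · exact Finset.card_le_card (Finset.biUnion_subset.2 fun _ _ => Finset.filter_subset _ _)
  · intro a _ b _ hab
    rw [Function.onFun, Finset.disjoint_left]
    intro σ ha hb
    simp only [Finset.mem_filter] at ha hb
    exact hab (ha.2.symm.trans hb.2)

lemma card_fixed_eq_numCycles {t : n.Partition} {σ : Equiv.Perm (Fin n)}
    (hσ : σ ∈ cyclicPermsFinset t) :
    (Finset.univ.filter fun i => σ i = i).card = numCycles t 1 := by
  rw [mem_cyclicPermsFinset] at hσ
  rw [numCycles, ← hσ, Equiv.Perm.parts_partition, Multiset.count_add,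
    Multiset.count_replicate_self, Multiset.count_eq_zero_of_notMem, zero_add,
    ← Finset.card_compl]
  · congr 1
    ext i
    simp
  · intro h
    have := Equiv.Perm.two_le_of_mem_cycleType h
    omega

lemma card_filter_apply_self (t : n.Partition) (i : Fin n) :
    n * ((cyclicPermsFinset t).filter fun σ => σ i = i).card =
      numCycles t 1 * (cyclicPermsFinset t).card := by
  have h : ∀ k ∈ Finset.univ, ((cyclicPermsFinset t).filter fun σ => σ k = k).card =
      ((cyclicPermsFinset t).filter fun σ => σ i = i).card := by
    intro k _
    rw [card_filter_conj (Equiv.swap i k)]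
    congr 1
    refine Finset.filter_congr fun σ _ => ?_
    rw [Equiv.swap_inv, Equiv.Perm.mul_apply, Equiv.Perm.mul_apply, Equiv.swap_apply_eq_iff,
      Equiv.swap_apply_right]
  have h2 := Finset.sum_congr rfl h
  rw [Finset.sum_const, Finset.card_univ, Fintype.card_fin, smul_eq_mul] at h2
  rw [← h2]
  simp only [Finset.card_filter]
  rw [Finset.sum_comm]
  simp only [← Finset.card_filter]
  rw [Finset.sum_congr rfl fun σ hσ => card_fixed_eq_numCycles hσ, Finset.sum_const, smul_eq_mul,
    mul_comm]

/-- The number of points of the graph of `σ` in the square of side `L` at the origin. -/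
def boxCount (σ : Equiv.Perm (Fin n)) (L : ℕ) : ℕ :=
  (Finset.univ.filter fun i : Fin n => (i : ℕ) < L ∧ (σ i : ℕ) < L).card

/-- An upper bound for the mean number of points of the graph of a uniformly random `t`-cyclic
permutation in the square of side `L` at the origin. -/
noncomputable def boxBound (t : n.Partition) (L : ℕ) : ℝ :=
  L * (numCycles t 1 / n) + L ^ 2 / (n - 1)

lemma card_filter_val_lt_le (n L : ℕ) :
    (Finset.univ.filter fun i : Fin n => (i : ℕ) < L).card ≤ L := by
  calc _ ≤ (Finset.range L).card :=
        Finset.card_le_card_of_injOn (fun i : Fin n => (i : ℕ))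
          (fun i hi => by simpa using hi) (fun a _ b _ h => Fin.ext h)
    _ = L := Finset.card_range L

lemma sum_boxCount_le (t : n.Partition) (hn : 2 ≤ n) (L : ℕ) :
    ∑ σ ∈ cyclicPermsFinset t, (boxCount σ L : ℝ) ≤
      (cyclicPermsFinset t).card * boxBound t L := by
  have hn' : (2 : ℝ) ≤ n := by exact_mod_cast hn
  have hn1 : (0 : ℝ) < n - 1 := by linarith
  set C := cyclicPermsFinset t with hC
  set I := Finset.univ.filter fun i : Fin n => (i : ℕ) < L with hI
  have hIL : (I.card : ℝ) ≤ L := by exact_mod_cast card_filter_val_lt_le n L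
  have hpt : ∀ i j : Fin n, ((C.filter fun σ => σ i = j).card : ℝ) ≤
      (if i = j then C.card * (numCycles t 1 / n : ℝ) else 0) + C.card / (n - 1) := by
    intro i j
    split_ifs with hij
    · subst hij
      have h := card_filter_apply_self t i
      have h' : (n : ℝ) * (C.filter fun σ => σ i = i).card = numCycles t 1 * C.card := by
        exact_mod_cast h
      have : ((C.filter fun σ => σ i = i).card : ℝ) = C.card * (numCycles t 1 / n) := by
        field_simp
        linarith
      rw [this]
      have : (0 : ℝ) ≤ C.card / (n - 1) := by positivity
      linarith
    · have h := card_filter_apply_eq_of_ne_le t hij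
      have h' : ((n : ℝ) - 1) * (C.filter fun σ => σ i = j).card ≤ C.card := by
        have : (((n - 1 : ℕ) : ℝ)) = (n : ℝ) - 1 := by
          rw [Nat.cast_sub (by omega)]; simp
        rw [← this]
        exact_mod_cast h
      rw [zero_add, le_div_iff₀ hn1]
      linarith
  have hbox : ∀ σ : Equiv.Perm (Fin n),
      boxCount σ L = ∑ i ∈ I, ∑ j ∈ I, if σ i = j then 1 else 0 := by
    intro σ
    rw [boxCount, ← Finset.filter_filter, Finset.card_filter]
    refine Finset.sum_congr rfl fun i _ => ?_
    rw [Finset.sum_ite_eq]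
    simp [hI]
  calc ∑ σ ∈ C, (boxCount σ L : ℝ)
      = ∑ i ∈ I, ∑ j ∈ I, ((C.filter fun σ => σ i = j).card : ℝ) := by
        simp_rw [hbox, Finset.card_filter]
        push_cast
        rw [Finset.sum_comm]
        refine Finset.sum_congr rfl fun i _ => ?_
        rw [Finset.sum_comm]
    _ ≤ ∑ i ∈ I, ∑ j ∈ I, ((if i = j then C.card * (numCycles t 1 / n : ℝ) else 0) +
          C.card / (n - 1)) :=
        Finset.sum_le_sum fun i _ => Finset.sum_le_sum fun j _ => hpt i j
    _ = C.card * (I.card * (numCycles t 1 / n) + (I.card : ℝ) ^ 2 / (n - 1)) := by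
        simp only [Finset.sum_add_distrib, Finset.sum_ite_eq, Finset.sum_const, nsmul_eq_mul,
          Finset.sum_ite_mem, Finset.inter_self]
        ring
    _ ≤ C.card * boxBound t L := by
        unfold boxBound
        gcongr

lemma mem_of_add_mul_eq {t : n.Partition} {p q : ℕ} (hp : 1 < p)
    (h : numCycles t 1 + p * numCycles t p = n) (hq : q ∈ t.parts) : q = 1 ∨ q = p := by
  -- The parts 1 and p already sum to n, so another positive part would exceed the total.
  by_contra! hne
  have hle : Multiset.replicate (t.parts.count 1) 1 + Multiset.replicate (t.parts.count p) p + {q}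
      ≤ t.parts := by
    rw [Multiset.le_iff_count]
    intro a
    simp only [Multiset.count_add, Multiset.count_replicate, Multiset.count_singleton]
    have := Multiset.one_le_count_iff_mem.2 hq
    split_ifs <;> subst_vars <;> omega
  obtain ⟨u, hu⟩ := Multiset.le_iff_exists_add.1 hle
  have h2 := congrArg Multiset.sum hu
  have h3 := t.parts_pos hq
  simp only [Multiset.sum_add, Multiset.sum_replicate, Multiset.sum_singleton, t.parts_sum,
    smul_eq_mul, numCycles] at h2 h
  rw [mul_comm p] at h
  omega

lemma pow_eq_one_of_mem_cyclicPermsFinset {t : n.Partition} {p : ℕ} (hp : 1 < p)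
    (h : numCycles t 1 + p * numCycles t p = n) {σ : Equiv.Perm (Fin n)}
    (hσ : σ ∈ cyclicPermsFinset t) : σ ^ p = 1 := by
  rw [← orderOf_dvd_iff_pow_eq_one, ← Equiv.Perm.lcm_cycleType, Multiset.lcm_dvd]
  intro q hq
  rw [mem_cyclicPermsFinset, Equiv.Perm.parts_partition] at hσ
  have hq2 := Equiv.Perm.two_le_of_mem_cycleType hq
  rcases mem_of_add_mul_eq hp h (hσ ▸ Multiset.mem_add.2 (Or.inl hq)) with rfl | rfl
  · omega
  · rfl

end CyclicPerms

/-! ### Splitting the records by position and value -/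

section Decomposition

variable {n : ℕ}

/-- The restriction of a permutation of `Fin n` to the elements below `m`. -/
def initialSeg {m : ℕ} (h : m ≤ n) (σ : Equiv.Perm (Fin n)) : Fin m → Fin n :=
  fun k => σ (Fin.castLE h k)

lemma initialSeg_injective {m : ℕ} (h : m ≤ n) (σ : Equiv.Perm (Fin n)) :
    Function.Injective (initialSeg h σ) :=
  σ.injective.comp (Fin.castLE_injective h)

lemma card_filter_lt_eq_numLeftMin {m : ℕ} (h : m ≤ n) (σ : Equiv.Perm (Fin n)) :
    (Finset.univ.filter fun i : Fin n => (∀ j, j < i → σ i < σ j) ∧ (i : ℕ) < m).card =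
      numLeftMin (initialSeg h σ) := by
  symm
  unfold numLeftMin
  refine Finset.card_bij (fun k _ => Fin.castLE h k) ?_ ?_ ?_
  · intro k hk
    simp only [Finset.mem_filter, Finset.mem_univ, true_and] at hk ⊢
    refine ⟨fun j hj => ?_, by simp⟩
    have hj' : (j : ℕ) < k := by simpa [Fin.lt_def] using hj
    exact hk ⟨j, hj'.trans k.2⟩ (Fin.lt_def.2 hj')
  · exact fun a _ b _ hab => Fin.castLE_injective h hab
  · intro i hi
    simp only [Finset.mem_filter, Finset.mem_univ, true_and] at hi
    refine ⟨⟨i, hi.2⟩, ?_, by ext; simp⟩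
    simp only [Finset.mem_filter, Finset.mem_univ, true_and]
    intro j hj
    exact hi.1 (Fin.castLE h j) (by simpa [Fin.lt_def] using hj)

/-- A record is a graph point with no other point to its lower left, a condition preserved by
passing to σ⁻¹. -/
lemma card_filter_apply_lt_eq_numLeftMin {m : ℕ} (h : m ≤ n) (σ : Equiv.Perm (Fin n)) :
    (Finset.univ.filter fun i : Fin n => (∀ j, j < i → σ i < σ j) ∧ (σ i : ℕ) < m).card =
      numLeftMin (initialSeg h σ⁻¹) := by
  rw [← card_filter_lt_eq_numLeftMin]
  refine Finset.card_equiv σ fun i => ?_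
  simp only [Finset.mem_filter, Finset.mem_univ, true_and, Equiv.Perm.inv_def, Equiv.symm_apply_apply]
  refine and_congr_left fun _ => ⟨fun hi j hj => ?_, fun hi j hj => ?_⟩
  · refine lt_of_le_of_ne (not_lt.1 fun hlt => ?_) fun heq => ?_
    · have := hi _ hlt
      rw [Equiv.apply_symm_apply] at this
      exact lt_asymm hj this
    · rw [heq] at hj
      simp at hj
  · refine lt_of_le_of_ne (not_lt.1 fun hlt => ?_) fun heq => ?_
    · have := hi _ hlt
      rw [Equiv.symm_apply_apply] at this
      exact lt_asymm hj this
    · exact hj.ne (σ.injective heq.symm)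

lemma lrec_eq_add {m : ℕ} (h : m ≤ n) (σ : Equiv.Perm (Fin n))
    (hσ : ∀ k : Fin m, m ≤ initialSeg h σ k) :
    lrec σ = numLeftMin (initialSeg h σ) + numLeftMin (initialSeg h σ⁻¹) +
      (Finset.univ.filter fun i : Fin n =>
        (∀ j, j < i → σ i < σ j) ∧ m ≤ i ∧ m ≤ σ i).card := by
  rw [← card_filter_lt_eq_numLeftMin, ← card_filter_apply_lt_eq_numLeftMin h, lrec,
    ← Finset.card_union_of_disjoint, ← Finset.card_union_of_disjoint]
  · congr 1
    ext i
    simp only [Finset.mem_filter, Finset.mem_union, Finset.mem_univ, true_and]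
    by_cases h1 : (i : ℕ) < m <;> by_cases h2 : (σ i : ℕ) < m <;> simp [h1, h2]
    · omega
  · rw [Finset.disjoint_left]
    intro i hi
    simp only [Finset.mem_filter, Finset.mem_union, Finset.mem_univ, true_and] at hi ⊢
    omega
  · rw [Finset.disjoint_left]
    intro i hi
    simp only [Finset.mem_filter, Finset.mem_univ, true_and, not_and] at hi ⊢
    intro _
    have := hσ ⟨i, hi.2⟩
    exact not_lt.2 this

/-- A record at position at least m lies below every value taken before m, hence below L; the same
argument for σ⁻¹ bounds its position. -/
lemma card_filter_remaining_le {m L : ℕ} (h : m ≤ n) (σ : Equiv.Perm (Fin n))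
    (h1 : ∃ k : Fin m, (initialSeg h σ k : ℕ) < L) (h2 : ∃ k : Fin m, (initialSeg h σ⁻¹ k : ℕ) < L) :
    (Finset.univ.filter fun i : Fin n =>
        (∀ j, j < i → σ i < σ j) ∧ m ≤ i ∧ m ≤ σ i).card ≤ boxCount σ L := by
  obtain ⟨k, hk⟩ := h1
  obtain ⟨l, hl⟩ := h2
  refine Finset.card_le_card fun i hi => ?_
  simp only [Finset.mem_filter, Finset.mem_univ, true_and] at hi ⊢
  obtain ⟨hi, hmi, hmσ⟩ := hi
  constructor
  · refine lt_of_le_of_lt ?_ hl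
    by_contra! hlt
    have := hi (σ⁻¹ (Fin.castLE h l)) (Fin.lt_def.2 hlt)
    rw [Equiv.Perm.inv_def, Equiv.apply_symm_apply, Fin.lt_def] at this
    simp at this
    omega
  · refine lt_trans (Fin.lt_def.1 (hi (Fin.castLE h k) ?_)) hk
    rw [Fin.lt_def]
    simp
    omega

end Decomposition

/-! ### Generating functions and error bounds on separated permutations -/

section Averages

variable {n m : ℕ}

lemma norm_recordPgf_le {x : ℂ} (hx : ‖x‖ = 1) (m : ℕ) : ‖recordPgf m x‖ ≤ 1 := by
  rw [recordPgf, norm_prod]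
  refine Finset.prod_le_one (fun _ _ => norm_nonneg _) fun j _ => ?_
  have h1 : ‖((j : ℂ) + 1)‖ = j + 1 := by
    have := Complex.norm_natCast (j + 1)
    push_cast at this
    exact this
  rw [norm_div, h1]
  refine div_le_one_of_le₀ ((norm_add_le _ _).trans ?_) (by positivity)
  rw [hx, Complex.norm_natCast, add_comm]

/-- The `t`-cyclic permutations that map no element below `m` to an element below `m`. -/
def separatedPerms (t : n.Partition) (h : m ≤ n) : Finset (Equiv.Perm (Fin n)) :=
  (cyclicPermsFinset t).filter fun σ => ∀ k : Fin m, m ≤ initialSeg h σ k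

lemma le_initialSeg_inv (h : m ≤ n) {σ : Equiv.Perm (Fin n)}
    (hσ : ∀ k : Fin m, m ≤ initialSeg h σ k) (k : Fin m) : m ≤ initialSeg h σ⁻¹ k := by
  by_contra! hlt
  have := hσ ⟨_, hlt⟩
  simp [initialSeg] at this
  omega

lemma initialSeg_conj (h : m ≤ n) {π : Equiv.Perm (Fin n)} (hπ : π ∈ fixingPerms n m)
    (σ : Equiv.Perm (Fin n)) : initialSeg h (π * σ * π⁻¹) = π ∘ initialSeg h σ := by
  ext k
  have : π⁻¹ (Fin.castLE h k) = Fin.castLE h k :=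
    mem_fixingPerms.1 (inv_mem_fixingPerms hπ) _ (by simp)
  simp only [initialSeg, Equiv.Perm.mul_apply, this, Function.comp]

lemma initialSeg_inv_conj (h : m ≤ n) {π : Equiv.Perm (Fin n)} (hπ : π ∈ fixingPerms n m)
    (σ : Equiv.Perm (Fin n)) : initialSeg h (π * σ * π⁻¹)⁻¹ = π ∘ initialSeg h σ⁻¹ := by
  rw [conj_inv, initialSeg_conj h hπ]

lemma conj_mem_separatedPerms {t : n.Partition} (h : m ≤ n) {π σ : Equiv.Perm (Fin n)}
    (hπ : π ∈ fixingPerms n m) (hσ : σ ∈ separatedPerms t h) :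
    π * σ * π⁻¹ ∈ separatedPerms t h := by
  rw [separatedPerms, Finset.mem_filter] at *
  refine ⟨(conj_mem_cyclicPermsFinset π).2 hσ.1, fun k => ?_⟩
  rw [initialSeg_conj h hπ]
  exact le_apply_of_mem_fixingPerms hπ (hσ.2 k)

/-- Conjugation by each π fixing the points below m permutes the separated permutations, so a sum
over them may first be averaged over these conjugations. -/
lemma card_mul_sum_separatedPerms {M : Type*} [CommSemiring M] (t : n.Partition) (h : m ≤ n)
    (F : Equiv.Perm (Fin n) → M) :
    (fixingPerms n m).card * ∑ σ ∈ separatedPerms t h, F σ =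
      ∑ σ ∈ separatedPerms t h, ∑ π ∈ fixingPerms n m, F (π * σ * π⁻¹) := by
  rw [Finset.sum_comm, ← nsmul_eq_mul, ← Finset.sum_const]
  refine Finset.sum_congr rfl fun π hπ => ?_
  symm
  refine Finset.sum_equiv (MulAut.conj π).toEquiv (fun σ => ?_) fun _ _ => rfl
  refine ⟨fun hσ => conj_mem_separatedPerms h hπ hσ, fun hσ => ?_⟩
  have := conj_mem_separatedPerms h (inv_mem_fixingPerms hπ) hσ
  simpa [mul_assoc] using this

lemma sum_separatedPerms_pow_of_sq_eq_one (t : n.Partition) (h : m ≤ n)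
    (h2 : ∀ σ ∈ cyclicPermsFinset t, σ ^ 2 = 1) (x : ℂ) :
    ∑ σ ∈ separatedPerms t h,
        x ^ (numLeftMin (initialSeg h σ) + numLeftMin (initialSeg h σ⁻¹)) =
      (separatedPerms t h).card * recordPgf m (x ^ 2) := by
  have h0 : ((fixingPerms n m).card : ℂ) ≠ 0 := Nat.cast_ne_zero.2 (card_fixingPerms_pos n m).ne'
  apply mul_left_cancel₀ h0
  rw [card_mul_sum_separatedPerms, mul_left_comm, ← nsmul_eq_mul (separatedPerms t h).card,
    ← Finset.sum_const]
  refine Finset.sum_congr rfl fun σ hσ => ?_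
  rw [separatedPerms, Finset.mem_filter] at hσ
  rw [← sum_fixingPerms_pow_numLeftMin _ (initialSeg_injective h σ) hσ.2]
  refine Finset.sum_congr rfl fun π hπ => ?_
  have hinv : σ⁻¹ = σ := by
    rw [inv_eq_iff_mul_eq_one, ← sq, h2 σ hσ.1]
  rw [initialSeg_inv_conj h hπ, initialSeg_conj h hπ, hinv, ← two_mul, pow_mul]

lemma sum_separatedPerms_pow_of_pow_three_eq_one (t : n.Partition) (h : m ≤ n)
    (h3 : ∀ σ ∈ cyclicPermsFinset t, σ ^ 3 = 1) (x : ℂ) :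
    ∑ σ ∈ separatedPerms t h,
        x ^ (numLeftMin (initialSeg h σ) + numLeftMin (initialSeg h σ⁻¹)) =
      (separatedPerms t h).card * recordPgf m x ^ 2 := by
  have h0 : ((fixingPerms n m).card : ℂ) ≠ 0 := Nat.cast_ne_zero.2 (card_fixingPerms_pos n m).ne'
  apply mul_left_cancel₀ h0
  rw [card_mul_sum_separatedPerms, mul_left_comm, ← nsmul_eq_mul (separatedPerms t h).card,
    ← Finset.sum_const]
  refine Finset.sum_congr rfl fun σ hσ => ?_
  rw [separatedPerms, Finset.mem_filter] at hσ
  have hinj : Function.Injective (Sum.elim (initialSeg h σ) (initialSeg h σ⁻¹)) := by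
    refine (initialSeg_injective h σ).sumElim (initialSeg_injective h σ⁻¹) fun k l hkl => ?_
    -- A common value σ k = σ⁻¹ l gives σ⁻¹ k = σ² k = l, which is below m and contradicts
    -- separation.
    have e : σ⁻¹ (Fin.castLE h k) = Fin.castLE h l := by
      have hs : σ⁻¹ = σ * σ := by
        rw [inv_eq_iff_mul_eq_one, ← mul_assoc]
        simpa [pow_succ] using h3 σ hσ.1
      rw [hs, Equiv.Perm.mul_apply]
      have := congrArg σ hkl
      simpa [initialSeg] using this
    have := le_initialSeg_inv h hσ.2 k
    rw [initialSeg, e] at this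
    simp at this
    omega
  rw [← sum_fixingPerms_pow_numLeftMin_add _ _ hinj hσ.2 (le_initialSeg_inv h hσ.2)]
  refine Finset.sum_congr rfl fun π hπ => ?_
  rw [initialSeg_inv_conj h hπ, initialSeg_conj h hπ]

lemma card_separatedPerms_avoid_le {L : ℕ} (t : n.Partition) (h : m ≤ n) (hL : L ≤ n)
    (g : Equiv.Perm (Fin n) → Fin m → Fin n) (hg : ∀ σ, Function.Injective (g σ))
    (hm : ∀ σ ∈ separatedPerms t h, ∀ k, m ≤ g σ k)
    (hconj : ∀ π ∈ fixingPerms n m, ∀ σ, g (π * σ * π⁻¹) = π ∘ g σ) :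
    (m + 1) * ((L - m) * ((separatedPerms t h).filter fun σ => ∀ k, L ≤ g σ k).card) ≤
      n * (separatedPerms t h).card := by
  refine Nat.le_of_mul_le_mul_left ?_ (card_fixingPerms_pos n m)
  have key := card_mul_sum_separatedPerms t h (fun σ => if ∀ k, L ≤ g σ k then 1 else 0)
  rw [← Finset.card_filter] at key
  calc _ = (m + 1) * ((L - m) * ((fixingPerms n m).card *
          ((separatedPerms t h).filter fun σ => ∀ k, L ≤ g σ k).card)) := by ring
    _ = ∑ σ ∈ separatedPerms t h, (m + 1) * ((L - m) *
          ∑ π ∈ fixingPerms n m, if ∀ k, L ≤ g (π * σ * π⁻¹) k then 1 else 0) := by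
        rw [← Finset.mul_sum, ← Finset.mul_sum]
        exact congrArg _ (congrArg _ key)
    _ ≤ ∑ σ ∈ separatedPerms t h, n * (fixingPerms n m).card := by
        refine Finset.sum_le_sum fun σ hσ => ?_
        refine le_trans (le_of_eq ?_) (card_fixingPerms_avoid_le hL (g σ) (hg σ) (hm σ hσ))
        rw [Finset.card_filter]
        congr 2
        refine Finset.sum_congr rfl fun π hπ => ?_
        rw [hconj π hπ σ]
        rfl
    _ = _ := by
        rw [Finset.sum_const, smul_eq_mul]
        ring

lemma norm_exp_pow_sub_one_le (s : ℝ) (r : ℕ) :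
    ‖Complex.exp (Complex.I * s) ^ r - 1‖ ≤ |s| * r := by
  rw [← Complex.exp_nat_mul]
  have := Real.norm_exp_I_mul_ofReal_sub_one_le (x := s * r)
  rw [Real.norm_eq_abs, abs_mul, Nat.abs_cast] at this
  refine le_trans (le_of_eq ?_) this
  congr 3
  push_cast
  ring

lemma norm_exp_I_mul_real (s : ℝ) : ‖Complex.exp (Complex.I * s)‖ = 1 := by
  rw [mul_comm, Complex.norm_exp_ofReal_mul_I]

/-- If a word avoids the values below L, the trivial bound 2 is used; otherwise the exponents differ
by at most the number of points in the box of side L. -/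
lemma norm_pow_lrec_sub_le {L : ℕ} (t : n.Partition) (h : m ≤ n) {σ : Equiv.Perm (Fin n)}
    (hσ : σ ∈ separatedPerms t h) (s : ℝ) :
    ‖Complex.exp (Complex.I * s) ^ lrec σ - Complex.exp (Complex.I * s) ^
        (numLeftMin (initialSeg h σ) + numLeftMin (initialSeg h σ⁻¹))‖ ≤
      2 * (if ∀ k, L ≤ (initialSeg h σ k : ℕ) then 1 else 0) +
        2 * (if ∀ k, L ≤ (initialSeg h σ⁻¹ k : ℕ) then 1 else 0) + |s| * boxCount σ L := by
  have hx := norm_exp_I_mul_real s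
  set x := Complex.exp (Complex.I * s) with hxdef
  rw [separatedPerms, Finset.mem_filter] at hσ
  have htriv : ∀ a b : ℕ, ‖x ^ a - x ^ b‖ ≤ 2 := fun a b => by
    refine (norm_sub_le _ _).trans ?_
    rw [norm_pow, norm_pow, hx]
    norm_num
  have h0 : 0 ≤ |s| * (boxCount σ L : ℝ) := by positivity
  by_cases h1 : ∀ k, L ≤ (initialSeg h σ k : ℕ)
  · have := htriv (lrec σ) (numLeftMin (initialSeg h σ) + numLeftMin (initialSeg h σ⁻¹))
    rw [if_pos h1]
    split_ifs <;> linarith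
  by_cases h2 : ∀ k, L ≤ (initialSeg h σ⁻¹ k : ℕ)
  · have := htriv (lrec σ) (numLeftMin (initialSeg h σ) + numLeftMin (initialSeg h σ⁻¹))
    rw [if_neg h1, if_pos h2]
    linarith
  rw [if_neg h1, if_neg h2, lrec_eq_add h σ hσ.2, pow_add x (_ + _)]
  push Not at h1 h2
  rw [← mul_sub_one, norm_mul, norm_pow, hx, one_pow, one_mul]
  refine (norm_exp_pow_sub_one_le s _).trans ?_
  have := card_filter_remaining_le h σ h1 h2
  have h3 : |s| * ((Finset.univ.filter fun i : Fin n =>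
      (∀ j, j < i → σ i < σ j) ∧ m ≤ i ∧ m ≤ σ i).card : ℝ) ≤ |s| * boxCount σ L := by
    gcongr
  linarith

lemma norm_sum_pow_lrec_sub_le {L : ℕ} (t : n.Partition) (hn : 2 ≤ n) (hmL : m < L) (hL : L ≤ n)
    (s : ℝ) {Φ : ℂ} (hΦ : ‖Φ‖ ≤ 1)
    (hsum : ∑ σ ∈ separatedPerms t (hmL.le.trans hL), Complex.exp (Complex.I * s) ^
        (numLeftMin (initialSeg (hmL.le.trans hL) σ) +
          numLeftMin (initialSeg (hmL.le.trans hL) σ⁻¹)) =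
      (separatedPerms t (hmL.le.trans hL)).card * Φ) :
    ‖∑ σ ∈ cyclicPermsFinset t, (Complex.exp (Complex.I * s) ^ lrec σ - Φ)‖ ≤
      (cyclicPermsFinset t).card *
        (2 * boxBound t m + 4 * (n / ((m + 1) * (L - m))) + |s| * boxBound t L) := by
  set h : m ≤ n := hmL.le.trans hL
  have hx := norm_exp_I_mul_real s
  set C := cyclicPermsFinset t with hC
  set G := separatedPerms t h with hG
  have hGC : G ⊆ C := Finset.filter_subset _ _
  have hLm : (0 : ℝ) < L - m := by
    rw [sub_pos]
    exact_mod_cast hmL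
  have hav : ∀ g : Equiv.Perm (Fin n) → Fin m → Fin n, (∀ σ, Function.Injective (g σ)) →
      (∀ σ ∈ G, ∀ k, m ≤ g σ k) →
      (∀ π ∈ fixingPerms n m, ∀ σ, g (π * σ * π⁻¹) = π ∘ g σ) →
      ∑ σ ∈ G, (if ∀ k, L ≤ (g σ k : ℕ) then (1 : ℝ) else 0) ≤
        C.card * (n / ((m + 1) * (L - m))) := by
    intro g hg hm hconj
    have h1 := card_separatedPerms_avoid_le t h hL g hg hm hconj
    have h2 : ((m : ℝ) + 1) * ((L - m) *
        ((G.filter fun σ => ∀ k, L ≤ (g σ k : ℕ)).card : ℝ)) ≤ n * G.card := by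
      rw [← Nat.cast_sub hmL.le]
      exact_mod_cast h1
    rw [← Finset.sum_filter, Finset.sum_const, nsmul_eq_mul, mul_one, ← mul_div_assoc,
      le_div_iff₀ (by positivity)]
    have h3 : (G.card : ℝ) ≤ C.card := by exact_mod_cast Finset.card_le_card hGC
    have h4 : (n : ℝ) * G.card ≤ n * C.card := by gcongr
    linarith
  have h1 := hav (fun σ => initialSeg h σ) (initialSeg_injective h)
    (fun σ hσ => (Finset.mem_filter.1 hσ).2) (fun π hπ σ => initialSeg_conj h hπ σ)
  have h2 := hav (fun σ => initialSeg h σ⁻¹) (fun σ => initialSeg_injective h σ⁻¹)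
    (fun σ hσ => le_initialSeg_inv h (Finset.mem_filter.1 hσ).2)
    (fun π hπ σ => initialSeg_inv_conj h hπ σ)
  have hbad : ‖∑ σ ∈ C \ G, (Complex.exp (Complex.I * s) ^ lrec σ - Φ)‖ ≤
      C.card * (2 * boxBound t m) := by
    calc _ ≤ ∑ σ ∈ C \ G, 2 * (boxCount σ m : ℝ) := by
          refine norm_sum_le_of_le _ fun σ hσ => ?_
          -- A permutation that is not separated has a point in the box of side m, so the first
          -- moment bounds how many there are.
          have hb : 1 ≤ boxCount σ m := by
            rw [Finset.mem_sdiff, hG, separatedPerms, Finset.mem_filter] at hσ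
            obtain ⟨k, hk⟩ : ∃ k : Fin m, (initialSeg h σ k : ℕ) < m := by
              by_contra! hh
              exact hσ.2 ⟨hσ.1, hh⟩
            refine Finset.card_pos.2 ⟨Fin.castLE h k, ?_⟩
            simp only [Finset.mem_filter, Finset.mem_univ, true_and]
            exact ⟨k.2, hk⟩
          have hb' : (1 : ℝ) ≤ boxCount σ m := by exact_mod_cast hb
          refine (norm_sub_le _ _).trans ?_
          rw [norm_pow, hx, one_pow]
          linarith
      _ ≤ ∑ σ ∈ C, 2 * (boxCount σ m : ℝ) :=
          Finset.sum_le_sum_of_subset_of_nonneg Finset.sdiff_subset fun _ _ _ => by positivity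
      _ = 2 * ∑ σ ∈ C, (boxCount σ m : ℝ) := by rw [Finset.mul_sum]
      _ ≤ _ := by
          have := sum_boxCount_le t hn m
          rw [← hC] at this
          linarith
  have hgood : ‖∑ σ ∈ G, (Complex.exp (Complex.I * s) ^ lrec σ - Φ)‖ ≤
      C.card * (4 * (n / ((m + 1) * (L - m))) + |s| * boxBound t L) := by
    have : ∑ σ ∈ G, (Complex.exp (Complex.I * s) ^ lrec σ - Φ) =
        ∑ σ ∈ G, (Complex.exp (Complex.I * s) ^ lrec σ - Complex.exp (Complex.I * s) ^
          (numLeftMin (initialSeg h σ) + numLeftMin (initialSeg h σ⁻¹))) := by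
      rw [Finset.sum_sub_distrib, Finset.sum_sub_distrib, hsum, Finset.sum_const, nsmul_eq_mul]
    rw [this]
    refine (norm_sum_le_of_le _ fun σ hσ =>
      norm_pow_lrec_sub_le (L := L) t h hσ s).trans ?_
    rw [Finset.sum_add_distrib, Finset.sum_add_distrib, ← Finset.mul_sum, ← Finset.mul_sum,
      ← Finset.mul_sum]
    have h3 : |s| * ∑ σ ∈ G, (boxCount σ L : ℝ) ≤ |s| * (C.card * boxBound t L) := by
      gcongr
      exact (Finset.sum_le_sum_of_subset_of_nonneg hGC fun _ _ _ => by positivity).trans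
        (sum_boxCount_le t hn L)
    linarith
  rw [← Finset.sum_sdiff hGC]
  refine (norm_add_le _ _).trans ?_
  linarith

end Averages

/-! ### Asymptotics of the record generating function -/

section Analysis

open Topology

lemma norm_prod_range_sub_prod_range_le (m : ℕ) (a b : ℕ → ℂ) (ha : ∀ j, ‖a j‖ ≤ 1)
    (hb : ∀ j, ‖b j‖ ≤ 1) :
    ‖∏ j ∈ Finset.range m, a j - ∏ j ∈ Finset.range m, b j‖ ≤
      ∑ j ∈ Finset.range m, ‖a j - b j‖ := by
  induction m with
  | zero => simp
  | succ m ih =>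
    have hb' : ‖∏ j ∈ Finset.range m, b j‖ ≤ 1 := by
      rw [norm_prod]
      exact Finset.prod_le_one (fun _ _ => norm_nonneg _) fun j _ => hb j
    rw [Finset.prod_range_succ, Finset.prod_range_succ, Finset.sum_range_succ]
    set A := ∏ j ∈ Finset.range m, a j
    set D := ∏ j ∈ Finset.range m, b j
    calc ‖A * a m - D * b m‖ = ‖(A - D) * a m + D * (a m - b m)‖ := by ring_nf
      _ ≤ ‖A - D‖ * ‖a m‖ + ‖D‖ * ‖a m - b m‖ := by
          refine (norm_add_le _ _).trans ?_
          rw [norm_mul, norm_mul]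
      _ ≤ ‖A - D‖ * 1 + 1 * ‖a m - b m‖ := by
          gcongr
          exact ha m
      _ ≤ _ := by linarith

lemma harmonic_cast_complex (m : ℕ) :
    ((harmonic m : ℝ) : ℂ) = ∑ j ∈ Finset.range m, 1 / ((j : ℂ) + 1) := by
  rw [harmonic]
  push_cast
  simp

/-- Poisson comparison: the factor 1 + (x - 1)/(j + 1) differs from exp((x - 1)/(j + 1)) by at most
|x - 1|²/(j + 1)², which is summable, so K does not depend on m. -/
lemma exists_norm_recordPgf_sub_exp_le :
    ∃ K : ℝ, 0 ≤ K ∧ ∀ (m : ℕ) (x : ℂ), ‖x‖ = 1 → ‖x - 1‖ ≤ 1 →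
      ‖recordPgf m x - Complex.exp ((x - 1) * (harmonic m : ℝ))‖ ≤ K * ‖x - 1‖ ^ 2 := by
  have hsm : Summable fun j : ℕ => 1 / ((j : ℝ) + 1) ^ 2 := by
    have := (summable_nat_add_iff 1).2 (Real.summable_one_div_nat_pow.2 (le_refl 2))
    simpa using this
  refine ⟨∑' j : ℕ, 1 / ((j : ℝ) + 1) ^ 2, tsum_nonneg fun _ => by positivity,
    fun m x hx hx1 => ?_⟩
  have hj : ∀ j : ℕ, ‖(j : ℂ) + 1‖ = j + 1 := fun j => by
    have := Complex.norm_natCast (j + 1)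
    push_cast at this
    exact this
  have hexp : Complex.exp ((x - 1) * (harmonic m : ℝ)) =
      ∏ j ∈ Finset.range m, Complex.exp ((x - 1) / (j + 1)) := by
    rw [harmonic_cast_complex, Finset.mul_sum, Complex.exp_sum]
    simp only [mul_one_div]
  rw [hexp, recordPgf]
  refine (norm_prod_range_sub_prod_range_le m _ _ ?_ ?_).trans ?_
  · intro j
    rw [norm_div, hj]
    refine div_le_one_of_le₀ ((norm_add_le _ _).trans ?_) (by positivity)
    rw [hx, Complex.norm_natCast, add_comm]
  · intro j
    rw [Complex.norm_exp, Real.exp_le_one_iff]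
    have h1 : x.re ≤ 1 := hx ▸ Complex.re_le_norm x
    have h2 : (x - 1) / ((j : ℂ) + 1) = (x - 1) / ((j + 1 : ℝ) : ℂ) := by push_cast; rfl
    rw [h2, Complex.div_ofReal_re]
    refine div_nonpos_of_nonpos_of_nonneg ?_ (by positivity)
    simpa using h1
  · calc _ ≤ ∑ j ∈ Finset.range m, 1 / ((j : ℝ) + 1) ^ 2 * ‖x - 1‖ ^ 2 := by
          refine Finset.sum_le_sum fun j _ => ?_
          have h0 : (j : ℂ) + 1 ≠ 0 := Nat.cast_add_one_ne_zero j
          have h1 : (x + j) / ((j : ℂ) + 1) = 1 + (x - 1) / (j + 1) := by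
            field_simp
            ring
          have h2 : ‖(x - 1) / ((j : ℂ) + 1)‖ = ‖x - 1‖ / (j + 1) := by rw [norm_div, hj]
          have h3 : ‖(x - 1) / ((j : ℂ) + 1)‖ ≤ 1 := by
            rw [h2]
            refine div_le_one_of_le₀ ?_ (by positivity)
            have : (0 : ℝ) ≤ j := by positivity
            linarith
          have := Complex.norm_exp_sub_one_sub_id_le h3
          rw [h1, norm_sub_rev, ← sub_sub]
          refine this.trans (le_of_eq ?_)
          rw [h2, div_pow, div_eq_mul_one_div, mul_comm]
      _ = (∑ j ∈ Finset.range m, 1 / ((j : ℝ) + 1) ^ 2) * ‖x - 1‖ ^ 2 := by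
          rw [Finset.sum_mul]
      _ ≤ _ := by
          gcongr
          exact hsm.sum_le_tsum _ fun _ _ => by positivity

/-- Second-order expansion at u = a/l with H = l²/2 + o(l): the linear term iuH is ial/2 + o(1),
which is why the error must be o(l) and not merely o(l²); the quadratic term tends to -a²/4 and the
cubic remainder is O(1/l). -/
lemma tendsto_exp_harmonic {H l : ℕ → ℝ} (hl : Tendsto l atTop atTop)
    (hH : Tendsto (fun n => (H n - l n ^ 2 / 2) / l n) atTop (𝓝 0)) (a : ℝ) :
    Tendsto (fun n => (Complex.exp (Complex.I * (a / l n : ℝ)) - 1) * (H n : ℂ) -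
      Complex.I * (a * l n / 2 : ℝ)) atTop (𝓝 (-((a ^ 2 / 4 : ℝ) : ℂ))) := by
  have hl0 : ∀ᶠ n in atTop, 0 < l n := hl.eventually_gt_atTop 0
  have hlinv : Tendsto (fun n => (l n)⁻¹) atTop (𝓝 0) := hl.inv_tendsto_atTop
  have hHl : Tendsto (fun n => H n / l n ^ 2) atTop (𝓝 (1 / 2)) := by
    have := (hH.mul hlinv).add_const (1 / 2 : ℝ)
    rw [zero_mul, zero_add] at this
    refine this.congr' ?_
    filter_upwards [hl0] with n hn
    field_simp
    ring
  have hu : Tendsto (fun n => a / l n) atTop (𝓝 0) := by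
    simpa [div_eq_mul_inv] using hlinv.const_mul a
  have h1 : Tendsto (fun n => (Complex.exp (Complex.I * (a / l n : ℝ)) - 1 -
      Complex.I * (a / l n : ℝ) + ((a / l n) ^ 2 / 2 : ℝ)) * (H n : ℂ)) atTop (𝓝 0) := by
    rw [tendsto_zero_iff_norm_tendsto_zero]
    have hb : Tendsto (fun n => |a| ^ 3 * (l n)⁻¹ * |H n / l n ^ 2|) atTop (𝓝 0) := by
      have := (hlinv.const_mul (|a| ^ 3)).mul hHl.abs
      simpa using this
    refine squeeze_zero' (Eventually.of_forall fun _ => norm_nonneg _) ?_ hb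
    have hsmall : ∀ᶠ n in atTop, |a / l n| ≤ 1 := by
      have := hu.abs
      rw [abs_zero] at this
      exact this.eventually_le_const zero_lt_one
    filter_upwards [hl0, hsmall] with n hn hs
    set u := a / l n with hudef
    have hz : ‖Complex.I * (u : ℂ)‖ = |u| := by simp
    have hexp := Complex.exp_bound (x := Complex.I * u) (by rw [hz]; exact hs)
      (n := 3) (by norm_num)
    rw [hz] at hexp
    have he : Complex.exp (Complex.I * u) - 1 - Complex.I * u + (u ^ 2 / 2 : ℝ) =
        Complex.exp (Complex.I * u) -
          ∑ k ∈ Finset.range 3, (Complex.I * u) ^ k / (k.factorial : ℂ) := by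
      simp only [Finset.sum_range_succ, Finset.sum_range_zero, mul_pow, Complex.I_sq,
        Nat.factorial]
      push_cast
      ring
    rw [norm_mul, he, Complex.norm_real, Real.norm_eq_abs]
    -- The constant of `Complex.exp_bound` at order 3, equal to 4/18.
    have hfac : (((Nat.succ 3 : ℕ) : ℝ) * (((Nat.factorial 3 : ℕ) : ℝ) * ((3 : ℕ) : ℝ))⁻¹) ≤ 1 := by
      norm_num [Nat.factorial]
    have hle : ‖Complex.exp (Complex.I * u) -
          ∑ k ∈ Finset.range 3, (Complex.I * u) ^ k / (k.factorial : ℂ)‖ ≤ |u| ^ 3 :=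
      hexp.trans (mul_le_of_le_one_right (by positivity) hfac)
    calc _ ≤ |u| ^ 3 * |H n| := by gcongr
      _ = |a| ^ 3 * (l n)⁻¹ * |H n / l n ^ 2| := by
          rw [hudef, abs_div, abs_div, abs_pow, abs_of_pos hn]
          field_simp
  have h2 : Tendsto (fun n => Complex.I * ((a * ((H n - l n ^ 2 / 2) / l n) : ℝ) : ℂ)) atTop
      (𝓝 0) := by
    have := (Complex.continuous_ofReal.tendsto _).comp (hH.const_mul a)
    simpa using this.const_mul Complex.I
  have h3 : Tendsto (fun n => ((a ^ 2 / 2 * (H n / l n ^ 2) : ℝ) : ℂ)) atTop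
      (𝓝 ((a ^ 2 / 4 : ℝ) : ℂ)) := by
    have h := (Complex.continuous_ofReal.tendsto _).comp (hHl.const_mul (a ^ 2 / 2))
    rw [show a ^ 2 / 2 * (1 / 2) = a ^ 2 / 4 by ring] at h
    exact h
  have := (h1.add h2).sub h3
  rw [zero_add, zero_sub] at this
  refine this.congr' ?_
  filter_upwards [hl0] with n hn
  have hn' : (l n : ℂ) ≠ 0 := by exact_mod_cast hn.ne'
  push_cast
  field_simp
  ring

lemma tendsto_recordPgf {m : ℕ → ℕ} {l : ℕ → ℝ} (hl : Tendsto l atTop atTop)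
    (hH : Tendsto (fun n => ((harmonic (m n) : ℝ) - l n ^ 2 / 2) / l n) atTop (𝓝 0)) (a : ℝ) :
    Tendsto (fun n => recordPgf (m n) (Complex.exp (Complex.I * (a / l n : ℝ))) *
      Complex.exp (-(Complex.I * (a * l n / 2 : ℝ)))) atTop
      (𝓝 (Complex.exp (-((a ^ 2 / 4 : ℝ) : ℂ)))) := by
  obtain ⟨K, hK, hKb⟩ := exists_norm_recordPgf_sub_exp_le
  have hu : Tendsto (fun n => |a / l n|) atTop (𝓝 0) := by
    have := (hl.inv_tendsto_atTop.const_mul a).abs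
    simpa [div_eq_mul_inv] using this
  have h1 := (Complex.continuous_exp.tendsto _).comp (tendsto_exp_harmonic hl hH a)
  refine tendsto_of_tendsto_of_dist h1 ?_
  have hb : Tendsto (fun n => K * |a / l n| ^ 2) atTop (𝓝 0) := by
    simpa using (hu.pow 2).const_mul K
  refine squeeze_zero' (Eventually.of_forall fun _ => dist_nonneg) ?_ hb
  filter_upwards [hu.eventually_le_const zero_lt_one] with n hn
  have hx := norm_exp_I_mul_real (a / l n)
  have hx1 := Real.norm_exp_I_mul_ofReal_sub_one_le (x := a / l n)
  rw [Real.norm_eq_abs] at hx1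
  have hneg : ‖Complex.exp (-(Complex.I * (a * l n / 2 : ℝ)))‖ = 1 := by
    have := norm_exp_I_mul_real (-(a * l n / 2))
    rwa [Complex.ofReal_neg, mul_neg] at this
  rw [dist_comm, dist_eq_norm, Function.comp, sub_eq_add_neg _ (Complex.I * _), Complex.exp_add,
    ← sub_mul, norm_mul, hneg, mul_one]
  refine (hKb (m n) _ hx (hx1.trans hn)).trans ?_
  gcongr

end Analysis

/-! ### Choice of the cutoffs -/

section Scales

open Topology

/-- A slowly growing scale. -/
noncomputable def slowScale (n : ℕ) : ℝ := Real.log n ^ ((16 : ℕ) : ℝ)⁻¹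

lemma slowScale_pow (n : ℕ) : slowScale n ^ 16 = Real.log n :=
  Real.rpow_inv_natCast_pow (Real.log_natCast_nonneg n) (by norm_num)

lemma slowScale_nonneg (n : ℕ) : 0 ≤ slowScale n :=
  Real.rpow_nonneg (Real.log_natCast_nonneg n) _

/-- The exponent 1/16 makes the normalization b⁸, which dominates both the O(b⁴) points in the outer
box and the error b in the harmonic sum. -/
lemma sqrt_log_eq_slowScale_pow (n : ℕ) : Real.sqrt (Real.log n) = slowScale n ^ 8 := by
  rw [← slowScale_pow, show slowScale n ^ 16 = (slowScale n ^ 8) ^ 2 by ring,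
    Real.sqrt_sq (pow_nonneg (slowScale_nonneg n) 8)]

lemma tendsto_slowScale : Tendsto slowScale atTop atTop :=
  (tendsto_rpow_atTop (by norm_num)).comp (Real.tendsto_log_atTop.comp tendsto_natCast_atTop_atTop)

lemma tendsto_sqrt_log : Tendsto (fun n : ℕ => Real.sqrt (Real.log n)) atTop atTop :=
  Real.tendsto_sqrt_atTop.comp (Real.tendsto_log_atTop.comp tendsto_natCast_atTop_atTop)

/-- The number of initial positions whose records are counted exactly. -/
noncomputable def innerCutoff (n : ℕ) : ℕ := ⌊Real.sqrt n / slowScale n⌋₊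

/-- The side of a box which, with high probability, contains all further records. -/
noncomputable def outerCutoff (n : ℕ) : ℕ := ⌊Real.sqrt n * slowScale n ^ 2⌋₊

lemma slowScale_sq_le_sqrt {n : ℕ} (hn : 1 ≤ n) (hB : 1 ≤ slowScale n) :
    slowScale n ^ 2 ≤ Real.sqrt n := by
  apply Real.le_sqrt_of_sq_le
  calc (slowScale n ^ 2) ^ 2 = slowScale n ^ 4 := by ring
    _ ≤ slowScale n ^ 16 := pow_le_pow_right₀ hB (by norm_num)
    _ = Real.log n := slowScale_pow n
    _ ≤ n - 1 := Real.log_le_sub_one_of_pos (by exact_mod_cast hn)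
    _ ≤ n := by linarith

lemma innerCutoff_le (n : ℕ) : (innerCutoff n : ℝ) ≤ Real.sqrt n / slowScale n :=
  Nat.floor_le (div_nonneg (Real.sqrt_nonneg _) (slowScale_nonneg n))

lemma outerCutoff_le (n : ℕ) : (outerCutoff n : ℝ) ≤ Real.sqrt n * slowScale n ^ 2 :=
  Nat.floor_le (mul_nonneg (Real.sqrt_nonneg _) (pow_nonneg (slowScale_nonneg n) 2))

lemma outerCutoff_le_self {n : ℕ} (hn : 1 ≤ n) (hB : 1 ≤ slowScale n) : outerCutoff n ≤ n := by
  have h : (outerCutoff n : ℝ) ≤ n := by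
    calc _ ≤ Real.sqrt n * slowScale n ^ 2 := outerCutoff_le n
      _ ≤ Real.sqrt n * Real.sqrt n := by
          gcongr
          exact slowScale_sq_le_sqrt hn hB
      _ = n := Real.mul_self_sqrt (by positivity)
  exact_mod_cast h

lemma cutoff_gap {n : ℕ} (hn : 1 ≤ n) (hB : 2 ≤ slowScale n) :
    Real.sqrt n * slowScale n ^ 2 / 2 ≤ (outerCutoff n : ℝ) - innerCutoff n := by
  have h1 : Real.sqrt n * slowScale n ^ 2 - 1 < outerCutoff n := Nat.sub_one_lt_floor _
  have hs : (1 : ℝ) ≤ Real.sqrt n := by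
    rw [Real.one_le_sqrt]
    exact_mod_cast hn
  have h2 : (innerCutoff n : ℝ) ≤ Real.sqrt n / 2 :=
    (innerCutoff_le n).trans (by gcongr)
  have h3 : Real.sqrt n * 4 ≤ Real.sqrt n * slowScale n ^ 2 := by
    gcongr
    nlinarith
  linarith

lemma innerCutoff_lt_outerCutoff {n : ℕ} (hn : 1 ≤ n) (hB : 2 ≤ slowScale n) :
    innerCutoff n < outerCutoff n := by
  have h := cutoff_gap hn hB
  have h2 : 0 < Real.sqrt n * slowScale n ^ 2 / 2 := by
    have : (0 : ℝ) < n := by exact_mod_cast hn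
    positivity
  have : (innerCutoff n : ℝ) < outerCutoff n := by linarith
  exact_mod_cast this

lemma div_cutoffs_le {n : ℕ} (hn : 1 ≤ n) (hB : 2 ≤ slowScale n) :
    (n : ℝ) / (((innerCutoff n : ℝ) + 1) * ((outerCutoff n : ℝ) - innerCutoff n)) ≤
      2 * (slowScale n)⁻¹ := by
  have hn' : (0 : ℝ) < n := by exact_mod_cast hn
  have h1 : Real.sqrt n / slowScale n ≤ innerCutoff n + 1 := (Nat.lt_floor_add_one _).le
  have h2 := cutoff_gap hn hB
  have hs : 0 < Real.sqrt n := Real.sqrt_pos.2 hn'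
  have hb : 0 < slowScale n := by linarith
  calc (n : ℝ) / (((innerCutoff n : ℝ) + 1) * ((outerCutoff n : ℝ) - innerCutoff n))
      ≤ n / (Real.sqrt n / slowScale n * (Real.sqrt n * slowScale n ^ 2 / 2)) := by gcongr
    _ = 2 * (slowScale n)⁻¹ := by
        nth_rewrite 1 [← Real.mul_self_sqrt hn'.le]
        field_simp

/-- Cutting at √n/b rather than √n changes the logarithm only by log b ≤ b - 1, and the harmonic sum
is within 1 of the logarithm. -/
lemma abs_harmonic_innerCutoff_sub_le {n : ℕ} (hn : 1 ≤ n) (hB : 1 ≤ slowScale n) :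
    |(harmonic (innerCutoff n) : ℝ) - Real.log n / 2| ≤ slowScale n := by
  have hn' : (0 : ℝ) < n := by exact_mod_cast hn
  have hs : 0 < Real.sqrt n := Real.sqrt_pos.2 hn'
  have hb : 0 < slowScale n := by linarith
  have hlog : Real.log (Real.sqrt n / slowScale n) = Real.log n / 2 - Real.log (slowScale n) := by
    rw [Real.log_div hs.ne' hb.ne', Real.log_sqrt hn'.le]
  have hlb : Real.log (slowScale n) ≤ slowScale n - 1 := Real.log_le_sub_one_of_pos hb
  have hlb0 : 0 ≤ Real.log (slowScale n) := Real.log_nonneg hB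
  have h1 : Real.log (Real.sqrt n / slowScale n) ≤ harmonic (innerCutoff n) :=
    log_le_harmonic_floor _ (by positivity)
  have hge : 1 ≤ Real.sqrt n / slowScale n := by
    rw [one_le_div hb]
    exact le_trans (by nlinarith) (slowScale_sq_le_sqrt hn hB)
  have h2 : (harmonic (innerCutoff n) : ℝ) ≤ 1 + Real.log (Real.sqrt n / slowScale n) :=
    harmonic_floor_le_one_add_log _ hge
  rw [hlog] at h1 h2
  rw [abs_le]
  constructor <;> linarith

lemma tendsto_harmonic_innerCutoff :
    Tendsto (fun n : ℕ => ((harmonic (innerCutoff n) : ℝ) - Real.sqrt (Real.log n) ^ 2 / 2) /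
      Real.sqrt (Real.log n)) atTop (𝓝 0) := by
  rw [tendsto_zero_iff_abs_tendsto_zero]
  refine squeeze_zero' (Eventually.of_forall fun _ => abs_nonneg _) ?_
    tendsto_slowScale.inv_tendsto_atTop
  filter_upwards [eventually_ge_atTop 1, tendsto_slowScale.eventually_ge_atTop 1] with n hn hB
  have h := abs_harmonic_innerCutoff_sub_le hn hB
  have hb : 0 < slowScale n := by linarith
  rw [Function.comp, abs_div, Real.sq_sqrt (Real.log_natCast_nonneg n), sqrt_log_eq_slowScale_pow,
    abs_of_pos (pow_pos hb 8), div_le_iff₀ (pow_pos hb 8)]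
  refine h.trans ?_
  rw [Pi.inv_apply, show slowScale n ^ 8 = slowScale n * slowScale n ^ 7 by ring,
    inv_mul_cancel_left₀ hb.ne']
  exact le_self_pow₀ hB (by norm_num)

/-- The O(√n) bound on fixed points keeps the diagonal contribution at cy; the factor 2 comes from n
- 1 ≥ n/2. -/
lemma boxBound_le {n L : ℕ} (t : n.Partition) (hn : 2 ≤ n) {c y : ℝ}
    (hc : (numCycles t 1 : ℝ) ≤ c * Real.sqrt n) (_hc0 : 0 ≤ c) (hy : (L : ℝ) ≤ Real.sqrt n * y) :
    boxBound t L ≤ c * y + 2 * y ^ 2 := by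
  have hn' : (2 : ℝ) ≤ n := by exact_mod_cast hn
  have hn0 : (0 : ℝ) < n := by linarith
  have hs : 0 < Real.sqrt n := Real.sqrt_pos.2 hn0
  have h0 : (0 : ℝ) ≤ L := by positivity
  unfold boxBound
  refine add_le_add ?_ ?_
  · calc (L : ℝ) * (numCycles t 1 / n) ≤ Real.sqrt n * y * (c * Real.sqrt n / n) := by
          gcongr
          exact h0.trans hy
      _ = (Real.sqrt n * Real.sqrt n) * (c * y / n) := by ring
      _ = c * y := by
          rw [Real.mul_self_sqrt hn0.le]
          field_simp
  · calc (L : ℝ) ^ 2 / (n - 1) ≤ (Real.sqrt n * y) ^ 2 / (n / 2) := by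
          gcongr
          linarith
      _ = 2 * y ^ 2 := by
          rw [mul_pow, Real.sq_sqrt hn0.le]
          field_simp

end Scales

/-! ### Characteristic function of the normalized record count -/

section CharacteristicFunction

open Topology

lemma charFun_map_of_hasLaw_uniformOn {n : ℕ} {t : n.Partition} {Ω : Type*} [MeasurableSpace Ω]
    {P : Measure Ω} [IsProbabilityMeasure P] {τ : Ω → Equiv.Perm (Fin n)}
    (hτ : HasLaw τ (uniformOn (cyclicPerms t)) P) (f : Equiv.Perm (Fin n) → ℝ) (θ : ℝ) :
    charFun (P.map fun ω => f (τ ω)) θ =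
      ((cyclicPermsFinset t).card : ℂ)⁻¹ *
        ∑ σ ∈ cyclicPermsFinset t, Complex.exp (θ * f σ * Complex.I) := by
  have hf : Measurable f := Measurable.of_discrete
  have hmap : P.map (fun ω => f (τ ω)) = (uniformOn (cyclicPerms t)).map f := by
    rw [← hτ.map_eq, AEMeasurable.map_map_of_aemeasurable hf.aemeasurable hτ.aemeasurable]
    rfl
  have hfin : IsFiniteMeasure (uniformOn (cyclicPerms t)) := by
    rw [← hτ.map_eq]
    infer_instance
  rw [hmap, charFun_apply_real, integral_map hf.aemeasurable (by fun_prop),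
    integral_fintype Integrable.of_finite, Finset.mul_sum,
    ← Finset.sum_subset (Finset.subset_univ (cyclicPermsFinset t))]
  · refine Finset.sum_congr rfl fun σ hσ => ?_
    rw [← coe_cyclicPermsFinset, Measure.real, ← Finset.coe_singleton, uniformOn_apply_finset,
      Finset.inter_singleton_of_mem hσ]
    simp
  · intro σ _ hσ
    rw [← coe_cyclicPermsFinset, Measure.real, ← Finset.coe_singleton, uniformOn_apply_finset,
      Finset.inter_singleton_of_notMem hσ]
    simp

lemma cyclicPermsFinset_nonempty_of_hasLaw {n : ℕ} {t : n.Partition} {Ω : Type*}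
    [MeasurableSpace Ω] {P : Measure Ω} [IsProbabilityMeasure P] {τ : Ω → Equiv.Perm (Fin n)}
    (hτ : HasLaw τ (uniformOn (cyclicPerms t)) P) : (cyclicPermsFinset t).Nonempty := by
  rw [Finset.nonempty_iff_ne_empty]
  intro h
  have h1 := (Measure.isProbabilityMeasure_map (μ := P) hτ.aemeasurable).ne_zero
  rw [hτ.map_eq, ← coe_cyclicPermsFinset, h, Finset.coe_empty, uniformOn_empty_meas] at h1
  exact h1 rfl

lemma charFun_normalized_lrec {n : ℕ} {t : n.Partition} {Ω : Type*} [MeasurableSpace Ω]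
    {P : Measure Ω} [IsProbabilityMeasure P] {τ : Ω → Equiv.Perm (Fin n)}
    (hτ : HasLaw τ (uniformOn (cyclicPerms t)) P) (θ : ℝ) :
    charFun (P.map fun ω => ((lrec (τ ω) : ℝ) - Real.log n) / Real.sqrt (Real.log n)) θ =
      ((cyclicPermsFinset t).card : ℂ)⁻¹ * (∑ σ ∈ cyclicPermsFinset t,
        Complex.exp (Complex.I * (θ / Real.sqrt (Real.log n) : ℝ)) ^ lrec σ) *
          Complex.exp (-(Complex.I * (θ * Real.sqrt (Real.log n) : ℝ))) := by
  rw [charFun_map_of_hasLaw_uniformOn hτ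
    (fun σ => ((lrec σ : ℝ) - Real.log n) / Real.sqrt (Real.log n)), mul_assoc, Finset.sum_mul]
  congr 1
  refine Finset.sum_congr rfl fun σ _ => ?_
  rw [← Complex.exp_nat_mul, ← Complex.exp_add, sub_div, Real.div_sqrt]
  congr 1
  push_cast
  ring

/-- If the number of records coming from small positions and small values has, on the separated
permutations, generating function `Φ`, then the normalized number of records has asymptotically
the corresponding characteristic function. -/
lemma tendsto_charFun_normalized_lrec (t : (n : ℕ) → n.Partition)
    (ht : (fun n : ℕ => (numCycles (t n) 1 : ℝ)) =O[atTop] (fun n : ℕ => Real.sqrt (n : ℝ)))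
    {Ω : ℕ → Type*} [∀ n, MeasurableSpace (Ω n)]
    (P : (n : ℕ) → Measure (Ω n)) [∀ n, IsProbabilityMeasure (P n)]
    (τ : (n : ℕ) → Ω n → Equiv.Perm (Fin n))
    (hτ : ∀ n, HasLaw (τ n) (uniformOn (cyclicPerms (t n))) (P n))
    (θ : ℝ) (Φ : ℕ → ℂ → ℂ) (hΦ : ∀ m x, ‖x‖ = 1 → ‖Φ m x‖ ≤ 1)
    (hsum : ∀ n m : ℕ, ∀ h : m ≤ n, ∀ x, ∑ σ ∈ separatedPerms (t n) h,
        x ^ (numLeftMin (initialSeg h σ) + numLeftMin (initialSeg h σ⁻¹)) =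
      (separatedPerms (t n) h).card * Φ m x) {z : ℂ}
    (hlim : Tendsto (fun n : ℕ =>
      Φ (innerCutoff n) (Complex.exp (Complex.I * (θ / Real.sqrt (Real.log n) : ℝ))) *
        Complex.exp (-(Complex.I * (θ * Real.sqrt (Real.log n) : ℝ)))) atTop (𝓝 z)) :
    Tendsto (fun n : ℕ => charFun ((P n).map fun ω =>
      ((lrec (τ n ω) : ℝ) - Real.log n) / Real.sqrt (Real.log n)) θ) atTop (𝓝 z) := by
  obtain ⟨c, hc0, hc⟩ := ht.exists_nonneg
  have hBinv : Tendsto (fun n => (slowScale n)⁻¹) atTop (𝓝 0) :=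
    tendsto_slowScale.inv_tendsto_atTop
  refine tendsto_of_tendsto_of_dist hlim ?_
  -- The three terms account for non-separated permutations, words avoiding the values below L, and
  -- remaining records: the last is |θ|b⁻⁸ times cb² + 2b⁴.
  set E : ℕ → ℝ := fun n =>
    2 * (c * (slowScale n)⁻¹ + 2 * (slowScale n)⁻¹ ^ 2) + 4 * (2 * (slowScale n)⁻¹) +
      |θ| * (c * (slowScale n)⁻¹ ^ 6 + 2 * (slowScale n)⁻¹ ^ 4) with hE
  have hE0 : Tendsto E atTop (𝓝 0) := by
    have := ((((hBinv.const_mul c).add ((hBinv.pow 2).const_mul 2)).const_mul 2).add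
      ((hBinv.const_mul 2).const_mul 4)).add
        ((((hBinv.pow 6).const_mul c).add ((hBinv.pow 4).const_mul 2)).const_mul |θ|)
    simpa [hE] using this
  refine squeeze_zero' (Eventually.of_forall fun _ => dist_nonneg) ?_ hE0
  filter_upwards [eventually_ge_atTop 2, tendsto_slowScale.eventually_ge_atTop 2, hc.bound]
    with n hn hB hcn
  have hb : 0 < slowScale n := by linarith
  have hcn' : (numCycles (t n) 1 : ℝ) ≤ c * Real.sqrt n := by
    simpa [abs_of_nonneg (Real.sqrt_nonneg _)] using hcn
  set s := θ / Real.sqrt (Real.log n) with hs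
  have hmL := innerCutoff_lt_outerCutoff (by omega) hB
  have hL := outerCutoff_le_self (n := n) (by omega) (by linarith)
  have hΦ1 := hΦ (innerCutoff n) _ (norm_exp_I_mul_real s)
  have hmain := norm_sum_pow_lrec_sub_le (t n) hn hmL hL s hΦ1 (hsum n _ _ _)
  have hC : (0 : ℝ) < (cyclicPermsFinset (t n)).card := by
    exact_mod_cast (cyclicPermsFinset_nonempty_of_hasLaw (hτ n)).card_pos
  have hC' : ((cyclicPermsFinset (t n)).card : ℂ) ≠ 0 := by exact_mod_cast hC.ne'
  have hneg : ‖Complex.exp (-(Complex.I * (θ * Real.sqrt (Real.log n) : ℝ)))‖ = 1 := by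
    have := norm_exp_I_mul_real (-(θ * Real.sqrt (Real.log n)))
    rwa [Complex.ofReal_neg, mul_neg] at this
  rw [dist_comm, dist_eq_norm, charFun_normalized_lrec (hτ n), ← sub_mul, norm_mul, hneg, mul_one]
  have heq : ((cyclicPermsFinset (t n)).card : ℂ)⁻¹ * (∑ σ ∈ cyclicPermsFinset (t n),
        Complex.exp (Complex.I * s) ^ lrec σ) - Φ (innerCutoff n) (Complex.exp (Complex.I * s)) =
      ((cyclicPermsFinset (t n)).card : ℂ)⁻¹ * ∑ σ ∈ cyclicPermsFinset (t n),
        (Complex.exp (Complex.I * s) ^ lrec σ -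
          Φ (innerCutoff n) (Complex.exp (Complex.I * s))) := by
    rw [Finset.sum_sub_distrib, Finset.sum_const, nsmul_eq_mul, mul_sub,
      inv_mul_cancel_left₀ hC']
  rw [heq, norm_mul, norm_inv, Complex.norm_natCast, inv_mul_le_iff₀ hC]
  refine hmain.trans ?_
  have hbm := boxBound_le (t n) hn hcn' hc0
    (y := (slowScale n)⁻¹) (by simpa [div_eq_mul_inv] using innerCutoff_le n)
  have hbL := boxBound_le (t n) hn hcn' hc0 (outerCutoff_le n)
  have hdiv := div_cutoffs_le (n := n) (by omega) hB
  have hsL : |s| * boxBound (t n) (outerCutoff n) ≤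
      |θ| * (c * (slowScale n)⁻¹ ^ 6 + 2 * (slowScale n)⁻¹ ^ 4) := by
    calc _ ≤ |s| * (c * slowScale n ^ 2 + 2 * (slowScale n ^ 2) ^ 2) := by gcongr
      _ = _ := by
          rw [hs, sqrt_log_eq_slowScale_pow, abs_div, abs_of_pos (pow_pos hb 8)]
          field_simp
  gcongr
  rw [hE]
  linarith

end CharacteristicFunction

theorem mainTheorem6
    (t : (n : ℕ) → n.Partition)
    (ht : (fun n : ℕ => (numCycles (t n) 1 : ℝ)) =O[atTop] (fun n : ℕ => Real.sqrt (n : ℝ)))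
    {Ω : ℕ → Type*} [∀ n, MeasurableSpace (Ω n)]
    (P : (n : ℕ) → Measure (Ω n)) [∀ n, IsProbabilityMeasure (P n)]
    (τ : (n : ℕ) → Ω n → Equiv.Perm (Fin n))
    (hτ : ∀ n, HasLaw (τ n) (uniformOn (cyclicPerms (t n))) (P n)) :
    ((∀ n, numCycles (t n) 1 + 2 * numCycles (t n) 2 = n) →
      TendstoInDistribution
        (fun (n : ℕ) (ω : Ω n) =>
          ((lrec (τ n ω) : ℝ) - Real.log (n : ℝ)) / Real.sqrt (Real.log (n : ℝ)))
        atTop (id : ℝ → ℝ) P (gaussianReal 0 2)) ∧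
    ((∀ n, numCycles (t n) 1 + 3 * numCycles (t n) 3 = n) →
      TendstoInDistribution
        (fun (n : ℕ) (ω : Ω n) =>
          ((lrec (τ n ω) : ℝ) - Real.log (n : ℝ)) / Real.sqrt (Real.log (n : ℝ)))
        atTop (id : ℝ → ℝ) P (gaussianReal 0 1)) := by
  have hmeas : ∀ n, AEMeasurable (fun ω : Ω n =>
      ((lrec (τ n ω) : ℝ) - Real.log (n : ℝ)) / Real.sqrt (Real.log (n : ℝ))) (P n) := fun n =>
    (Measurable.of_discrete (f := fun σ : Equiv.Perm (Fin n) =>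
      ((lrec σ : ℝ) - Real.log (n : ℝ)) / Real.sqrt (Real.log (n : ℝ)))).comp_aemeasurable
        (hτ n).aemeasurable
  have hrec := fun a : ℝ => tendsto_recordPgf tendsto_sqrt_log tendsto_harmonic_innerCutoff a
  refine ⟨fun h2 => ⟨hmeas, aemeasurable_id, ?_⟩, fun h3 => ⟨hmeas, aemeasurable_id, ?_⟩⟩
  · refine ProbabilityMeasure.tendsto_iff_tendsto_charFun.2 fun θ => ?_
    simp only [ProbabilityMeasure.coe_mk, Measure.map_id, charFun_gaussianReal]
    refine tendsto_charFun_normalized_lrec t ht P τ hτ θ (fun m x => recordPgf m (x ^ 2))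
      (fun m x hx => norm_recordPgf_le (by rw [norm_pow, hx, one_pow]) m)
      (fun n m h x => sum_separatedPerms_pow_of_sq_eq_one (t n) h
        (fun σ hσ => pow_eq_one_of_mem_cyclicPermsFinset one_lt_two (h2 n) hσ) x) ?_
    -- Doubling one count replaces θ by 2θ, and (2θ)²/4 = θ² is the exponent for variance 2.
    have := hrec (2 * θ)
    convert this using 2 with n
    · rw [← Complex.exp_nat_mul]
      congr 2
      · congr 1
        push_cast
        ring
      · push_cast
        ring_nf
    · congr 1
      push_cast
      ring
  · refine ProbabilityMeasure.tendsto_iff_tendsto_charFun.2 fun θ => ?_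
    simp only [ProbabilityMeasure.coe_mk, Measure.map_id, charFun_gaussianReal]
    refine tendsto_charFun_normalized_lrec t ht P τ hτ θ (fun m x => recordPgf m x ^ 2)
      (fun m x hx => by
        rw [norm_pow]
        exact pow_le_one₀ (norm_nonneg _) (norm_recordPgf_le hx m))
      (fun n m h x => sum_separatedPerms_pow_of_pow_three_eq_one (t n) h
        (fun σ hσ => pow_eq_one_of_mem_cyclicPermsFinset (by norm_num) (h3 n) hσ) x) ?_
    -- Two independent counts square the limit, and 2·θ²/4 = θ²/2 is the exponent for variance 1.
    have := (hrec θ).pow 2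
    convert this using 2 with n
    · rw [mul_pow]
      congr 1
      rw [← Complex.exp_nat_mul]
      congr 1
      push_cast
      ring
    · rw [← Complex.exp_nat_mul]
      congr 1
      push_cast
      ring
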